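/- **Setting.** A server holds $N$ files and serves $K$ users over a noiseless broadcast link; each user has a cache of size $M>0$ files. Write $q=\lceil N/M\rceil$. Each file is split into $F=qF'$ packets, arranged in $F'$ groups of $q$ packets. *NewPlacement.* Each user, for each file and each of its $F'$ groups, stores one packet of the group, chosen uniformly at random; all choices are independent. *NewDelivery* (for a set $U$ of users with demands $d_k$, where $S_{n,f}\subseteq U$ is the set of users of $U$ assumed to store packet $f$ of file $n$). Start with $C=\emptyset$ and run through all pairs $(k,f)$, $k\in U$, $f$ a packet index, in any order. If $k\in S_{d_k,f}$ or $(k,f)\in C$, skip the pair. Otherwise, for each $j\in S_{d_k,f}$ for which there is an $f'$ with $(j,f')\notin C$ and $S_{d_j,f'}=(S_{d_k,f}\cup\{k\})\setminus\{j\}$, select one such $f'$ (by any rule); transmit the XOR of packet $f$ of file $d_k$ with packet $f'$ of file $d_j$ for all selected pairs $(j,f')$, and add $(k,f)$ and all selected pairs to $C$. *ModifiedDelivery* with target gain $g$. First replace each $S_{n,f}$ with $|S_{n,f}|\ge g+1$ by a uniformly random $g$-subset of itself, independently over all packets $(n,f)$; then run NewDelivery with the new sets. The rate is the number of transmitted packets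 divided by $F$. **Theorem.** Let $\lceil N/M\rceil\ge e$ and let $g$ be an integer with $7\le g\le\frac{(N/M)^2}{3\log(N/M)}$. Let $K'=\big\lceil\lceil N/M\rceil\,3g\log(N/M)\big\rceil$, let $K$ be a multiple of $K'$, and divide the users into groups of size $K'$. Use NewPlacement, and run ModifiedDelivery with target gain $g$ separately in each group (with the sets of users of that group storing each packet, and with independent randomness in the groups). There are an absolute constant $c>0$ and a function $\varepsilon$ with $\varepsilon(x)\to0$ as $x\to\infty$ such that, with $$F_0=\lceil N/M\rceil\left\lceil c\binom{K'}{g}\Big(\log\binom{K'}{g}\Big)^2\right\rceil ,$$ for all such $N,M,g,K$, all file sizes $F=\lceil N/M\rceil F'\ge F_0$ and every demand pattern, the expected total rate over all groups (with respect to the placement and the delivery) is at most $$\frac43\,\frac{K}{g+1}\,\bigl(1+\varepsilon(K')\bigr).$$ Moreover, with absolute implied constants, $$F_0=O\!\left(\binom{K'}{g}\Big(\log\binom{K'}{g}\Big)^2\lceil N/M\rceil\right)\quad\text{and}\quad F_0=O\!\left(\lceil N/M\rceil^{g+1}(3e)^g(\log(N/M))^{g+2}g^2\right),$$ and, for every $A>0$,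 in the range $g\le A\,N/M$ (in particular for every fixed $g$), $F_0=O_A\!\left((N/M)^{g+1}(3e)^g(\log(N/M))^{g+2}g^2\right)$. -/

import Mathlib

namespace CodedCaching

open Finset

/-- A cache configuration for users `U`, a library of `N` files and packets (of each file) `P`:
`S n f` is the exact set of users that store packet `f` of file `n`. -/
abbrev Config (U P : Type) (N : ℕ) : Type := Fin N → P → Finset U

/-- The possible outcomes of the random placement: every file consists of `F'` groups of `q` packets,
and every user `k` chooses, for every file `n` and every group `f'`, one packet of that group.
The placement chooses uniformly among these outcomes, i.e. all the choices are uniform and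
mutually independent. -/
abbrev Placement (U : Type) (N F' q : ℕ) : Type := U → Fin N → Fin F' → Fin q

/-- The cache configuration of a placement; the packet `(f', i)` is the `i`-th packet of the
`f'`-th group, so a file has `F' * q` packets. -/
def Placement.config {U : Type} [Fintype U] {N F' q : ℕ} (ω : Placement U N F' q) :
    Config U (Fin F' × Fin q) N :=
  fun n p => univ.filter fun k => ω k n p.1 = p.2

/-- What the description of the delivery algorithm leaves open: the order in which the
main loop runs through all pairs (user, packet of the requested file), and the choice of one packet
whenever several are suitable. -/
structure Schedule (U P : Type) where
  order : List (U × P)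
  nodup : order.Nodup
  complete : ∀ x, x ∈ order
  pick : ∀ s : Finset P, s.Nonempty → {f : P // f ∈ s}

section Delivery

variable {U P : Type} [DecidableEq U] [Fintype P] [DecidableEq P] {N : ℕ}

/-- The packets not yet covered by `C` that are requested by `j` and stored exactly in
`S_{d_k,f} ∪ {k} - {j}`. -/
def candidates (S : Config U P N) (d : U → Fin N) (C : Finset (U × P)) (x : U × P) (j : U) :
    Finset P :=
  univ.filter fun f' => (j, f') ∉ C ∧ S (d j) f' = (insert x.1 (S (d x.1) x.2)).erase j

/-- The set `A` of packets that are XORed with the packet `x = (k, f)`: one candidate for each user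
`j ∈ S_{d_k,f}` that has one. -/
def partners (σ : Schedule U P) (S : Config U P N) (d : U → Fin N) (C : Finset (U × P))
    (x : U × P) : Finset (U × P) :=
  (S (d x.1) x.2).biUnion fun j =>
    if h : (candidates S d C x j).Nonempty then {(j, (σ.pick _ h).1)} else ∅

/-- One iteration of the main loop. The state is the pair of the set `C` of covered packets and the
list of the transmissions made so far, a transmission being the set of packets that are XORed. -/
def deliveryStep (σ : Schedule U P) (S : Config U P N) (d : U → Fin N)
    (st : Finset (U × P) × List (Finset (U × P))) (x : U × P) :
    Finset (U × P) × List (Finset (U × P)) :=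
  if x.1 ∈ S (d x.1) x.2 ∨ x ∈ st.1 then st
  else (st.1 ∪ insert x (partners σ S d st.1 x), insert x (partners σ S d st.1 x) :: st.2)

/-- The list of the transmissions of the greedy clique cover delivery (`NewDelivery`) for the cache
configuration `S` and the demands `d`. -/
def newDelivery (σ : Schedule U P) (S : Config U P N) (d : U → Fin N) :
    List (Finset (U × P)) :=
  (σ.order.foldl (deliveryStep σ S d) (∅, [])).2

/-- The normalized number of transmissions: number of packets sent divided by the number of
packets per file. -/
noncomputable def deliveryRate (σ : Schedule U P) (S : Config U P N) (d : U → Fin N) : ℝ :=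
  ((newDelivery σ S d).length : ℝ) / (Fintype.card P : ℝ)

/-- The possible outcomes of the pull-down phase with target gain `g`: every `S n f` with at least
`g + 1` elements is replaced by one of its `g`-subsets. The pull-down phase chooses uniformly among
these outcomes, i.e. the `g`-subsets are uniform and independent over all packets. (Files that are
not requested have no influence on the delivery.) -/
def pullDown (g : ℕ) (S : Config U P N) : Finset (Config U P N) :=
  Fintype.piFinset fun n => Fintype.piFinset fun f =>
    if g + 1 ≤ (S n f).card then (S n f).powersetCard g else {S n f}

end Delivery

/-- The users of group `j`. -/
abbrev Group {K m : ℕ} (grp : Fin K → Fin m) (j : Fin m) : Type := {k : Fin K // grp k = j}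

/-- The cache configuration seen by the users of group `j`. -/
def groupConfig {K m N F' q : ℕ} (grp : Fin K → Fin m) (ω : Placement (Fin K) N F' q)
    (j : Fin m) : Config (Group grp j) (Fin F' × Fin q) N :=
  Placement.config fun k => ω k.1

/-- The expectation, over the random placement and over the random pull-down phases of all groups,
of the total normalized number of transmissions when `ModifiedDelivery` (pull-down phase followed
by `NewDelivery`) is run separately in every group of users. -/
noncomputable def expectedTotalRate {K m N F' q : ℕ} (g : ℕ) (grp : Fin K → Fin m)
    (σ : ∀ j, Schedule (Group grp j) (Fin F' × Fin q)) (d : Fin K → Fin N) : ℝ :=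
  Finset.expect (univ : Finset (Placement (Fin K) N F' q)) fun ω =>
    Finset.expect (Fintype.piFinset fun j => pullDown g (groupConfig grp ω j)) fun T =>
      ∑ j, deliveryRate (σ j) (T j) fun k => d k.1

/-- `⌈N/M⌉`. -/
noncomputable def ratio (N : ℕ) (M : ℝ) : ℕ := ⌈(N : ℝ) / M⌉₊

/-- The group size `⌈N/M⌉ · 3 g log (N/M)`, rounded up to an integer. -/
noncomputable def groupSize (N : ℕ) (M : ℝ) (g : ℕ) : ℕ :=
  ⌈(ratio N M : ℝ) * (3 * g * Real.log ((N : ℝ) / M))⌉₊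

/-- `binom(K', g) (log binom(K', g))²` for the group size `K'`. -/
noncomputable def groupOrder (N : ℕ) (M : ℝ) (g : ℕ) : ℝ :=
  ((groupSize N M g).choose g : ℝ) * Real.log ((groupSize N M g).choose g : ℝ) ^ 2

/-- The range of the parameters. -/
def Admissible (N : ℕ) (M : ℝ) (g : ℕ) : Prop :=
  0 < M ∧ Real.exp 1 ≤ (ratio N M : ℝ) ∧ 7 ≤ g ∧
    (g : ℝ) ≤ ((N : ℝ) / M) ^ 2 / (3 * Real.log ((N : ℝ) / M))

/-- The number of packets per file `F = ⌈N/M⌉ F'` with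
`F' = ⌈c binom(K', g) (log binom(K', g))²⌉`. -/
noncomputable def fileSize (c : ℝ) (N : ℕ) (M : ℝ) (g : ℕ) : ℕ :=
  ratio N M * ⌈c * groupOrder N M g⌉₊

end CodedCaching

-- The delivery is controlled by a potential. For a set `B` of users, a member `k` may have
-- uncovered requested packets stored exactly in `B.erase k`; `remaining` sums over `B` the largest
-- such number. Each transmission serves one packet of every member of some `B` that still has one,
-- so it lowers the potential by at least one (`remaining_lt`), whatever the schedule. Hence the
-- number of transmissions is at most the initial potential.
--
-- After the pull-down no set exceeds `g` users. The sets `B` of size `g + 1` contribute a maximum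
-- of `g + 1` counts; all other `B` together contribute at most the number of requested packets with
-- fewer than `g` users (`remaining_empty_le`). By symmetry each count has mean at most `Λ = F /
-- binom(K', g)`, and its variance is at most its mean. A second-moment bound gives expected maximum
-- at most `Λ (1 + s)` with `s ^ 2 = (g + 1) / Λ`, and summing over `B` yields `K' / (g + 1) * (1 +
-- s)`. A Chernoff bound handles the remaining packets (`pulledExpect_deliveryRate_le`).
--
-- The file size makes `Λ` at least `q g ^ 2`, and the group size makes the Chernoff term `O(1 /
-- q)`. Since `K'` is at most `2 q ^ 3`, both errors vanish as `K'` grows. The rate is thus `K / (g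
-- + 1)` up to a factor tending to one, within the stated `4 / 3`.

namespace CodedCaching

open Finset

-- Uniform expectations on product spaces

section Expectation

/-- The expectation of a product of functions of independent coordinates. -/
theorem prod_expect_piFinset {ι : Type*} [Fintype ι] [DecidableEq ι] {κ : ι → Type*}
    (t : ∀ i, Finset (κ i)) (f : ∀ i, κ i → ℝ) :
    Finset.expect (Fintype.piFinset t) (fun x => ∏ i, f i (x i)) =
      ∏ i, Finset.expect (t i) (f i) := by
  simp only [Finset.expect_eq_sum_div_card, Finset.prod_div_distrib, Finset.prod_univ_sum,
    Fintype.card_piFinset, Nat.cast_prod]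

theorem expect_piFinset_apply {ι : Type*} [Fintype ι] [DecidableEq ι] {κ : ι → Type*}
    (t : ∀ i, Finset (κ i)) (ht : ∀ i, (t i).Nonempty) (i : ι) (f : κ i → ℝ) :
    Finset.expect (Fintype.piFinset t) (fun x => f (x i)) = Finset.expect (t i) f := by
  have h := prod_expect_piFinset t (Function.update (fun _ _ => (1 : ℝ)) i f)
  have h1 : ∀ x : ∀ j, κ j, ∏ j, Function.update (fun _ _ => (1 : ℝ)) i f j (x j) = f (x i) := by
    intro x
    rw [Finset.prod_eq_single i]
    · simp
    · intro j _ hj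
      simp [hj]
    · simp
  simp only [h1] at h
  rw [h, Finset.prod_eq_single i]
  · simp
  · intro j _ hj
    simp [hj, Finset.expect_const (ht j)]
  · simp

theorem expect_piFinset_mul {ι : Type*} [Fintype ι] [DecidableEq ι] {κ : ι → Type*}
    (t : ∀ i, Finset (κ i)) (ht : ∀ i, (t i).Nonempty) {i j : ι} (hij : i ≠ j)
    (f : κ i → ℝ) (g : κ j → ℝ) :
    Finset.expect (Fintype.piFinset t) (fun x => f (x i) * g (x j)) =
      Finset.expect (t i) f * Finset.expect (t j) g := by
  have h := prod_expect_piFinset t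
    (Function.update (Function.update (fun _ _ => (1 : ℝ)) i f) j g)
  have h1 : ∀ x : ∀ j, κ j,
      ∏ l, Function.update (Function.update (fun _ _ => (1 : ℝ)) i f) j g l (x l) =
        f (x i) * g (x j) := by
    intro x
    rw [Finset.prod_eq_mul i j hij]
    · simp [hij]
    · rintro l _ ⟨hi, hj⟩
      simp [hi, hj]
    · simp
    · simp
  simp only [h1] at h
  rw [h, Finset.prod_eq_mul i j hij]
  · simp [hij]
  · rintro l _ ⟨hi, hj⟩
    simp [hi, hj, Finset.expect_const (ht l)]
  · simp
  · simp

/-- Two functions on a product space that depend on complementary sets of coordinates, as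
witnessed by a map `mix` that takes the former from its first and the latter from its second
argument, are independent. -/
theorem expect_mul_of_mix {Ω : Type*} [Fintype Ω] (mix : Ω → Ω → Ω)
    (h₁ : ∀ a b, mix (mix a b) (mix b a) = a) (f g : Ω → ℝ)
    (hf : ∀ a b, f (mix a b) = f a) (hg : ∀ a b, g (mix a b) = g b) :
    Finset.expect univ (fun ω => f ω * g ω) = Finset.expect univ f * Finset.expect univ g := by
  rcases isEmpty_or_nonempty Ω with hΩ | hΩ
  · simp
  -- Swapping coordinates between two independent copies preserves the uniform measure and carries
  -- `f a * g b` to `f` and `g` evaluated at the same point.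
  have hinv : Function.Involutive fun p : Ω × Ω => (mix p.1 p.2, mix p.2 p.1) := by
    rintro ⟨a, b⟩
    simp [h₁]
  have h := Fintype.expect_equiv hinv.toPerm
    (fun p : Ω × Ω => f p.1 * g p.2) (fun p : Ω × Ω => f p.1 * g p.1) (by
      rintro ⟨a, b⟩
      simp [Function.Involutive.toPerm, hf, hg])
  rw [← Finset.univ_product_univ, Finset.expect_product, Finset.expect_product] at h
  simp only [Fintype.expect_const] at h
  rw [← h, Finset.expect_mul_expect]

/-- A uniform function, restricted to a subtype, is uniform. -/
theorem expect_restrict {ι V : Type*} [Fintype ι] [DecidableEq ι] [Fintype V] [Nonempty V]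
    (p : ι → Prop) [DecidablePred p] (f : ({i // p i} → V) → ℝ) :
    Finset.expect (univ : Finset (ι → V)) (fun ω => f fun i => ω i.1) =
      Finset.expect univ f := by
  have h := Fintype.expect_equiv (Equiv.piEquivPiSubtypeProd p fun _ => V)
    (fun ω => f fun i => ω i.1) (fun x => f x.1) (fun ω => rfl)
  rw [h, ← Finset.univ_product_univ, Finset.expect_product]
  simp only [Fintype.expect_const]

end Expectation

-- The potential bounding the number of transmissions

section Delivery

variable {U P : Type} [DecidableEq U] [Fintype P] [DecidableEq P] {N : ℕ}

/-- The packets requested by `k` and stored exactly in `B - {k}`, except those in `C`. -/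
def uncovered (S : Config U P N) (d : U → Fin N) (C : Finset (U × P)) (B : Finset U) (k : U) :
    Finset P :=
  univ.filter fun f => (k, f) ∉ C ∧ S (d k) f = B.erase k

theorem uncovered_anti (S : Config U P N) (d : U → Fin N) {C C' : Finset (U × P)} (h : C ⊆ C')
    (B : Finset U) (k : U) : uncovered S d C' B k ⊆ uncovered S d C B k := by
  intro f hf
  simp only [uncovered, mem_filter, mem_univ, true_and] at hf ⊢
  exact ⟨fun h' => hf.1 (h h'), hf.2⟩

variable [Fintype U]

/-- An upper bound for the number of transmissions still to be made when the packets in `C` are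
covered: for each `B`, the largest number of uncovered packets of a member of `B`. -/
def remaining (S : Config U P N) (d : U → Fin N) (C : Finset (U × P)) : ℕ :=
  ∑ B : Finset U, B.sup fun k => #(uncovered S d C B k)

/-- Only the term of `B = S ∪ {k}` matters, since enlarging `C` never increases a term. Every member
of `B` with an uncovered packet loses one: `k` loses `x`, any other `j` its selected candidate. The
maximum is positive because of `x`, so it drops strictly even if some members had nothing left. -/
theorem remaining_lt (σ : Schedule U P) (S : Config U P N) (d : U → Fin N) (C : Finset (U × P))
    (x : U × P) (hx : x.1 ∉ S (d x.1) x.2) (hC : x ∉ C) :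
    remaining S d (C ∪ insert x (partners σ S d C x)) < remaining S d C := by
  set C' := C ∪ insert x (partners σ S d C x)
  have hCC' : C ⊆ C' := subset_union_left
  set B := insert x.1 (S (d x.1) x.2) with hB
  have hxB : x.2 ∈ uncovered S d C B x.1 := by
    simp [uncovered, hB, hC, erase_insert hx]
  have hpos : ⊥ < B.sup fun k => #(uncovered S d C B k) :=
    lt_of_lt_of_le (card_pos.2 ⟨_, hxB⟩)
      (le_sup (f := fun k => #(uncovered S d C B k)) (mem_insert_self x.1 _))
  refine sum_lt_sum (fun D _ => sup_mono_fun fun k _ => card_le_card (uncovered_anti S d hCC' D k))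
    ⟨B, mem_univ _, (Finset.sup_lt_iff hpos).2 fun k hk => ?_⟩
  rcases (uncovered S d C B k).eq_empty_or_nonempty with h | h
  · have := uncovered_anti S d hCC' B k
    rw [h, subset_empty] at this
    rw [this]
    simpa using hpos
  · refine lt_of_lt_of_le (card_lt_card ?_) (le_sup (f := fun k => #(uncovered S d C B k)) hk)
    rw [Finset.ssubset_iff_of_subset (uncovered_anti S d hCC' B k)]
    rcases eq_or_ne k x.1 with rfl | hne
    · exact ⟨x.2, hxB, by simp [uncovered, C']⟩
    · have hkS : k ∈ S (d x.1) x.2 := by simpa [hB, hne] using hk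
      -- The candidates of `k` relative to `x` are by definition its uncovered packets at `B`.
      have hc : (candidates S d C x k).Nonempty := h
      refine ⟨(σ.pick _ hc).1, (σ.pick _ hc).2, ?_⟩
      have : (k, (σ.pick _ hc).1) ∈ C' := by
        refine mem_union_right _ (mem_insert_of_mem ?_)
        rw [partners, mem_biUnion]
        exact ⟨k, hkS, by simp [hc]⟩
      simp [uncovered, this]

theorem length_foldl_deliveryStep_le (σ : Schedule U P) (S : Config U P N) (d : U → Fin N)
    (l : List (U × P)) (st : Finset (U × P) × List (Finset (U × P))) :
    (l.foldl (deliveryStep σ S d) st).2.length ≤ st.2.length + remaining S d st.1 := by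
  induction l generalizing st with
  | nil => simp
  | cons x l ih =>
    rw [List.foldl_cons]
    refine (ih _).trans ?_
    unfold deliveryStep
    split_ifs with h
    · exact le_rfl
    · push Not at h
      have := remaining_lt σ S d st.1 x h.1 h.2
      simp only [List.length_cons]
      omega

theorem length_newDelivery_le (σ : Schedule U P) (S : Config U P N) (d : U → Fin N) :
    (newDelivery σ S d).length ≤ remaining S d ∅ := by
  simpa [newDelivery] using length_foldl_deliveryStep_le σ S d σ.order (∅, [])

/-- The number of transmissions when all `S n f` have at most `g` elements. -/
theorem remaining_empty_le {g : ℕ} (S : Config U P N) (d : U → Fin N)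
    (hS : ∀ n f, #(S n f) ≤ g) :
    remaining S d ∅ ≤ ∑ B ∈ powersetCard (g + 1) (univ : Finset U),
        (B.sup fun k => #{f | S (d k) f = B.erase k}) + ∑ k, #{f | #(S (d k) f) < g} := by
  have hu : ∀ (B : Finset U) k, uncovered S d ∅ B k = ({f | S (d k) f = B.erase k} : Finset P) := by
    intro B k
    simp [uncovered]
  simp only [remaining, hu]
  rw [← Finset.sum_filter_add_sum_filter_not univ (fun B : Finset U => #B = g + 1)]
  have hE : univ.filter (fun B : Finset U => #B = g + 1) = powersetCard (g + 1) univ := by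
    ext B
    simp [mem_powersetCard]
  rw [hE]
  refine Nat.add_le_add_left ?_ _
  calc ∑ B : Finset U with ¬ #B = g + 1, B.sup (fun k => #{f | S (d k) f = B.erase k})
      ≤ ∑ B : Finset U with ¬ #B = g + 1,
          ∑ k, ∑ f, if k ∈ B ∧ S (d k) f = B.erase k then 1 else 0 := by
        refine sum_le_sum fun B _ => Finset.sup_le fun k hk => ?_
        refine le_trans (le_of_eq ?_) (single_le_sum
          (f := fun k => ∑ f, if k ∈ B ∧ S (d k) f = B.erase k then 1 else 0)
          (fun _ _ => Nat.zero_le _) (mem_univ k))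
        simp only [hk, true_and, card_filter]
    _ = ∑ k, ∑ f, ∑ B : Finset U with ¬ #B = g + 1,
          if k ∈ B ∧ S (d k) f = B.erase k then 1 else 0 := by
        rw [sum_comm]
        refine sum_congr rfl fun k _ => ?_
        rw [sum_comm]
    _ ≤ ∑ k, ∑ f, if #(S (d k) f) < g then 1 else 0 := by
        refine sum_le_sum fun k _ => sum_le_sum fun f _ => ?_
        rw [← card_filter]
        -- A pair `(k, f)` determines `B`, so it is counted at most once. As `#(B.erase k)` is at
        -- most `g` and `#B` is not `g + 1`, it is counted only if fewer than `g` users store the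
        -- packet.
        have key : ∀ B ∈ ((univ : Finset (Finset U)).filter (fun B => ¬ #B = g + 1)).filter
            (fun B => k ∈ B ∧ S (d k) f = B.erase k),
            B = insert k (S (d k) f) ∧ #(S (d k) f) < g := by
          intro B hB
          simp only [mem_filter, mem_univ, true_and] at hB
          obtain ⟨h1, h2, h3⟩ := hB
          refine ⟨by rw [h3, insert_erase h2], ?_⟩
          have h4 := hS (d k) f
          rw [h3, card_erase_of_mem h2] at h4 ⊢
          have := card_pos.2 ⟨k, h2⟩
          omega
        split_ifs with h
        · refine card_le_one.2 fun B hB B' hB' => ?_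
          rw [(key B hB).1, (key B' hB').1]
        · rw [Nat.le_zero, card_eq_zero, eq_empty_iff_forall_notMem]
          exact fun B hB => h (key B hB).2
    _ = ∑ k, #{f | #(S (d k) f) < g} := by simp only [card_filter]

end Delivery

-- The random pull-down to sets of size `g`

section PullDown

variable {U P : Type} [Fintype P] [DecidableEq P] {N : ℕ}

/-- The possible outcomes of the pull-down phase for a packet stored in `R`. -/
def pullDownChoices (g : ℕ) (R : Finset U) : Finset (Finset U) :=
  if g + 1 ≤ #R then R.powersetCard g else {R}

theorem mem_pullDownChoices {g : ℕ} {R A : Finset U} :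
    A ∈ pullDownChoices g R ↔ (g + 1 ≤ #R ∧ A ⊆ R ∧ #A = g) ∨ (#R ≤ g ∧ A = R) := by
  unfold pullDownChoices
  split_ifs with h
  · simp [mem_powersetCard, h]
    omega
  · simp only [mem_singleton]
    constructor
    · exact fun h' => Or.inr ⟨by omega, h'⟩
    · rintro (h' | h')
      · omega
      · exact h'.2

theorem pullDownChoices_nonempty (g : ℕ) (R : Finset U) : (pullDownChoices g R).Nonempty := by
  unfold pullDownChoices
  split_ifs with h
  · exact powersetCard_nonempty.2 (by omega)
  · exact singleton_nonempty R

theorem pullDown_eq (g : ℕ) (S : Config U P N) :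
    pullDown g S = Fintype.piFinset fun n => Fintype.piFinset fun f => pullDownChoices g (S n f) :=
  rfl

theorem pullDown_nonempty (g : ℕ) (S : Config U P N) : (pullDown g S).Nonempty := by
  simp only [pullDown_eq, Fintype.piFinset_nonempty]
  exact fun n f => pullDownChoices_nonempty g _

theorem mem_pullDown {g : ℕ} {S T : Config U P N} :
    T ∈ pullDown g S ↔ ∀ n f, T n f ∈ pullDownChoices g (S n f) := by
  simp only [pullDown_eq, Fintype.mem_piFinset]

theorem card_le_of_mem_pullDown {g : ℕ} {S T : Config U P N} (hT : T ∈ pullDown g S)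
    (n : Fin N) (f : P) : #(T n f) ≤ g := by
  rcases mem_pullDownChoices.1 (mem_pullDown.1 hT n f) with h | h
  · exact h.2.2.le
  · rw [h.2]
    exact h.1

/-- Shrunken sets have exactly `g` elements, so the event can be read off the placement alone, as
the Chernoff bound requires. -/
theorem card_lt_iff_of_mem_pullDown {g : ℕ} {S T : Config U P N} (hT : T ∈ pullDown g S)
    (n : Fin N) (f : P) : #(T n f) < g ↔ #(S n f) < g := by
  rcases mem_pullDownChoices.1 (mem_pullDown.1 hT n f) with h | h
  · omega
  · rw [h.2]

theorem expect_pullDown_apply (g : ℕ) (S : Config U P N) (n : Fin N) (f : P)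
    (φ : Finset U → ℝ) :
    Finset.expect (pullDown g S) (fun T => φ (T n f)) =
      Finset.expect (pullDownChoices g (S n f)) φ := by
  rw [pullDown_eq]
  refine (expect_piFinset_apply _ (fun n => Fintype.piFinset_nonempty.2 fun f =>
    pullDownChoices_nonempty g _) n fun v : P → Finset U => φ (v f)).trans ?_
  exact expect_piFinset_apply _ (fun f => pullDownChoices_nonempty g _) f φ

theorem expect_pullDown_mul (g : ℕ) (S : Config U P N) (n : Fin N) {f f' : P} (hf : f ≠ f')
    (φ ψ : Finset U → ℝ) :
    Finset.expect (pullDown g S) (fun T => φ (T n f) * ψ (T n f')) =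
      Finset.expect (pullDownChoices g (S n f)) φ *
        Finset.expect (pullDownChoices g (S n f')) ψ := by
  rw [pullDown_eq]
  refine (expect_piFinset_apply _ (fun n => Fintype.piFinset_nonempty.2 fun f =>
    pullDownChoices_nonempty g _) n fun v : P → Finset U => φ (v f) * ψ (v f')).trans ?_
  exact expect_piFinset_mul _ (fun f => pullDownChoices_nonempty g _) hf φ ψ

variable [DecidableEq U]

/-- The probability that the pull-down phase turns `R` into `A`. -/
noncomputable def pullDownProb (g : ℕ) (A R : Finset U) : ℝ :=
  Finset.expect (pullDownChoices g R) fun A' => if A' = A then 1 else 0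

theorem pullDownProb_nonneg (g : ℕ) (A R : Finset U) : 0 ≤ pullDownProb g A R :=
  expect_nonneg fun _ _ => by split_ifs <;> norm_num

theorem pullDownProb_eq_zero {g : ℕ} {A R : Finset U} (h : ¬ A ⊆ R) : pullDownProb g A R = 0 := by
  refine expect_eq_zero fun A' hA' => if_neg ?_
  rintro rfl
  rcases mem_pullDownChoices.1 hA' with h' | h'
  · exact h h'.2.1
  · exact h h'.2.subset

theorem pullDownProb_map (g : ℕ) (A R : Finset U) (π : Equiv.Perm U) :
    pullDownProb g (A.map π.toEmbedding) (R.map π.toEmbedding) = pullDownProb g A R := by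
  symm
  refine expect_equiv π.finsetCongr (fun A' => ?_) (fun A' _ => ?_)
  · simp [mem_pullDownChoices, map_subset_map]
  · simp

theorem sum_pullDownProb_le (g : ℕ) (R : Finset U) (s : Finset (Finset U)) :
    ∑ A ∈ s, pullDownProb g A R ≤ 1 := by
  unfold pullDownProb
  rw [← expect_sum_comm]
  refine expect_le (pullDownChoices_nonempty g R) fun A' _ => ?_
  rw [sum_ite_eq]
  split_ifs <;> norm_num

end PullDown

-- Moments of the counts after placement and pull-down

section Mean

variable {U : Type} [Fintype U] {N F' q : ℕ}

theorem config_perm (ω : Placement U N F' q) (π : Equiv.Perm U) (n : Fin N)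
    (f : Fin F' × Fin q) :
    Placement.config (fun k => ω (π.symm k)) n f = (ω.config n f).map π.toEmbedding := by
  ext k
  simp [Placement.config, mem_map_equiv]

variable [DecidableEq U]

/-- The expectation of a function of the cache configuration after placement and pull-down. -/
noncomputable def pulledExpect (g : ℕ) (φ : Config U (Fin F' × Fin q) N → ℝ) : ℝ :=
  Finset.expect (univ : Finset (Placement U N F' q)) fun ω => Finset.expect (pullDown g ω.config) φ

theorem pulledExpect_add (g : ℕ) (φ ψ : Config U (Fin F' × Fin q) N → ℝ) :
    pulledExpect g (fun T => φ T + ψ T) = pulledExpect g φ + pulledExpect g ψ := by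
  simp only [pulledExpect, expect_add_distrib]

theorem pulledExpect_const_mul (g : ℕ) (a : ℝ) (φ : Config U (Fin F' × Fin q) N → ℝ) :
    pulledExpect g (fun T => a * φ T) = a * pulledExpect g φ := by
  simp only [pulledExpect, mul_expect]

theorem pulledExpect_sum (g : ℕ) {ι : Type*} (s : Finset ι)
    (φ : ι → Config U (Fin F' × Fin q) N → ℝ) :
    pulledExpect g (fun T => ∑ i ∈ s, φ i T) = ∑ i ∈ s, pulledExpect g (φ i) := by
  simp only [pulledExpect, expect_sum_comm]

theorem pulledExpect_const (hq : 0 < q) (g : ℕ) (a : ℝ) :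
    pulledExpect g (fun _ : Config U (Fin F' × Fin q) N => a) = a := by
  have : NeZero q := ⟨hq.ne'⟩
  simp only [pulledExpect, expect_const (pullDown_nonempty g _)]
  exact Fintype.expect_const a

theorem pulledExpect_mono (g : ℕ) {φ ψ : Config U (Fin F' × Fin q) N → ℝ}
    (h : ∀ T, (∀ n f, #(T n f) ≤ g) → φ T ≤ ψ T) : pulledExpect g φ ≤ pulledExpect g ψ :=
  expect_le_expect fun _ _ => expect_le_expect fun T hT =>
    h T (card_le_of_mem_pullDown hT)

/-- The probability that, after the pull-down phase, packet `f` of file `n` is stored exactly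
in `A`. -/
noncomputable def storedProb (g : ℕ) (n : Fin N) (f : Fin F' × Fin q) (A : Finset U) : ℝ :=
  Finset.expect (univ : Finset (Placement U N F' q)) fun ω => pullDownProb g A (ω.config n f)

theorem storedProb_nonneg (g : ℕ) (n : Fin N) (f : Fin F' × Fin q) (A : Finset U) :
    0 ≤ storedProb g n f A :=
  expect_nonneg fun _ _ => pullDownProb_nonneg _ _ _

/-- Placement and pull-down are invariant under relabelling users, and a bijection `A ≃ A'` extends
to a permutation of all users. -/
theorem storedProb_eq_of_card_eq (g : ℕ) (n : Fin N) (f : Fin F' × Fin q) {A A' : Finset U}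
    (h : #A = #A') : storedProb g n f A = storedProb g n f A' := by
  set e : {x // x ∈ A} ≃ {x // x ∈ A'} := equivOfCardEq h
  set π : Equiv.Perm U := e.extendSubtype
  have hπ : A.map π.toEmbedding = A' := by
    refine eq_of_subset_of_card_le (fun y hy => ?_) (by simp [h])
    obtain ⟨x, hx, rfl⟩ := mem_map.1 hy
    exact e.extendSubtype_mem x hx
  refine Fintype.expect_equiv (Equiv.arrowCongr π (Equiv.refl _)) _ _ fun ω => ?_
  rw [← pullDownProb_map g A _ π, hπ, ← config_perm]
  rfl

/-- The events for different `g`-sets are disjoint and, by symmetry, equally likely. -/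
theorem storedProb_le (hq : 0 < q) (g : ℕ) (n : Fin N) (f : Fin F' × Fin q) {A : Finset U}
    (hA : #A = g) : storedProb g n f A ≤ 1 / ((Fintype.card U).choose g : ℝ) := by
  have : NeZero q := ⟨hq.ne'⟩
  have h1 : ∑ A' ∈ powersetCard g (univ : Finset U), storedProb g n f A' ≤ 1 := by
    unfold storedProb
    rw [← expect_sum_comm]
    exact expect_le univ_nonempty fun ω _ => sum_pullDownProb_le g _ _
  rw [sum_congr rfl fun A' hA' =>
    storedProb_eq_of_card_eq g n f ((mem_powersetCard.1 hA').2.trans hA.symm)] at h1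
  rw [sum_const, card_powersetCard, card_univ, nsmul_eq_mul] at h1
  have h2 : 0 < ((Fintype.card U).choose g : ℝ) := by
    refine Nat.cast_pos.2 (Nat.choose_pos ?_)
    rw [← hA]
    exact card_le_univ A
  rw [le_div_iff₀ h2]
  linarith

theorem pulledExpect_indicator (g : ℕ) (n : Fin N) (f : Fin F' × Fin q) (A : Finset U) :
    pulledExpect g (fun T => if T n f = A then 1 else 0) = storedProb g n f A := by
  unfold pulledExpect storedProb pullDownProb
  exact expect_congr rfl fun ω _ =>
    expect_pullDown_apply g _ n f fun R => if R = A then (1 : ℝ) else 0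

/-- Packets of different groups are independent, and two packets of the same group are never
stored by the same users. -/
theorem pulledExpect_indicator_mul_le (g : ℕ) (n : Fin N) {f f' : Fin F' × Fin q} (hf : f ≠ f')
    {A : Finset U} (hA : A.Nonempty) :
    pulledExpect g (fun T => (if T n f = A then 1 else 0) * (if T n f' = A then 1 else 0)) ≤
      storedProb g n f A * storedProb g n f' A := by
  have h : pulledExpect g
      (fun T : Config U (Fin F' × Fin q) N =>
        (if T n f = A then 1 else 0) * (if T n f' = A then 1 else 0)) =
      Finset.expect (univ : Finset (Placement U N F' q)) fun ω =>
        pullDownProb g A (ω.config n f) * pullDownProb g A (ω.config n f') := by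
    unfold pulledExpect pullDownProb
    exact expect_congr rfl fun ω _ =>
      expect_pullDown_mul g _ n hf (fun R => if R = A then (1 : ℝ) else 0)
        fun R => if R = A then (1 : ℝ) else 0
  rw [h]
  by_cases h1 : f.1 = f'.1
  · refine le_trans (le_of_eq (expect_eq_zero fun ω _ => ?_))
      (mul_nonneg (storedProb_nonneg _ _ _ _) (storedProb_nonneg _ _ _ _))
    obtain ⟨k, hk⟩ := hA
    have h2 : f.2 ≠ f'.2 := fun h2 => hf (Prod.ext h1 h2)
    by_cases hs : A ⊆ ω.config n f
    · have h3 : ω k n f.1 = f.2 := by simpa [Placement.config] using hs hk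
      refine mul_eq_zero_of_right _ (pullDownProb_eq_zero fun hs' => ?_)
      have h4 : ω k n f'.1 = f'.2 := by simpa [Placement.config] using hs' hk
      rw [← h1, h3] at h4
      exact h2 h4
    · rw [pullDownProb_eq_zero hs, zero_mul]
  -- The mixed placement takes the choices in the group of `f` from `a` and all others from `b`.
  · refine le_of_eq (expect_mul_of_mix
      (fun a b : Placement U N F' q => fun k n' l => if l = f.1 then a k n' l else b k n' l)
      (fun a b => ?_) _ _ (fun a b => ?_) fun a b => ?_)
    · funext k n' l
      by_cases hl : l = f.1 <;> simp [hl]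
    · simp [Placement.config]
    · simp [Placement.config, Ne.symm h1]

/-- The mean number of packets of file `n` stored exactly in `A` after the pull-down phase. -/
noncomputable def storedMean (F' q : ℕ) (g : ℕ) (n : Fin N) (A : Finset U) : ℝ :=
  ∑ f : Fin F' × Fin q, storedProb g n f A

theorem storedMean_le (hq : 0 < q) (g : ℕ) (n : Fin N) {A : Finset U} (hA : #A = g) :
    storedMean F' q g n A ≤ F' * q / ((Fintype.card U).choose g : ℝ) := by
  refine (sum_le_card_nsmul _ _ _ fun f _ => storedProb_le hq g n f hA).trans (le_of_eq ?_)
  simp [div_eq_mul_inv]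

theorem pulledExpect_count (g : ℕ) (n : Fin N) (A : Finset U) :
    pulledExpect g (fun T : Config U (Fin F' × Fin q) N => (#{f | T n f = A} : ℝ)) =
      storedMean F' q g n A := by
  simp only [card_filter, Nat.cast_sum, Nat.cast_ite, Nat.cast_one, Nat.cast_zero,
    pulledExpect_sum, pulledExpect_indicator, storedMean]

/-- The diagonal of the squared sum of indicators gives the mean. Distinct packets are not
positively correlated, so the off-diagonal part is at most the squared mean. -/
theorem pulledExpect_count_sq_le (g : ℕ) (n : Fin N) {A : Finset U} (hA : A.Nonempty) :
    pulledExpect g (fun T : Config U (Fin F' × Fin q) N => (#{f | T n f = A} : ℝ) ^ 2) ≤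
      storedMean F' q g n A + storedMean F' q g n A ^ 2 := by
  simp only [card_filter, Nat.cast_sum, Nat.cast_ite, Nat.cast_one, Nat.cast_zero, sq,
    sum_mul_sum, pulledExpect_sum, storedMean]
  rw [← sum_add_distrib]
  refine sum_le_sum fun f _ => ?_
  rw [← add_sum_erase _ _ (mem_univ f)]
  have h1 : pulledExpect g (fun T : Config U (Fin F' × Fin q) N =>
      (if T n f = A then (1 : ℝ) else 0) * (if T n f = A then 1 else 0)) = storedProb g n f A := by
    rw [← pulledExpect_indicator]
    congr 1
    funext T
    split_ifs <;> simp
  rw [h1]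
  gcongr
  refine (sum_le_sum fun f' hf' =>
    pulledExpect_indicator_mul_le g n (ne_of_mem_erase hf').symm hA).trans ?_
  exact sum_le_sum_of_subset_of_nonneg (erase_subset _ _)
    fun _ _ _ => mul_nonneg (storedProb_nonneg _ _ _ _) (storedProb_nonneg _ _ _ _)

theorem pulledExpect_variance_le (hq : 0 < q) (g : ℕ) (n : Fin N) {A : Finset U}
    (hA : A.Nonempty) :
    pulledExpect g (fun T : Config U (Fin F' × Fin q) N =>
      ((#{f | T n f = A} : ℝ) - storedMean F' q g n A) ^ 2) ≤ storedMean F' q g n A := by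
  set m := storedMean F' q g n A
  have h : (fun T : Config U (Fin F' × Fin q) N => ((#{f | T n f = A} : ℝ) - m) ^ 2) =
      fun T => (#{f | T n f = A} : ℝ) ^ 2 + (-(2 * m) * (#{f | T n f = A} : ℝ) + m ^ 2) := by
    funext T
    ring
  rw [h, pulledExpect_add, pulledExpect_add, pulledExpect_const_mul, pulledExpect_count,
    pulledExpect_const hq]
  have := pulledExpect_count_sq_le (F' := F') (q := q) g n hA
  linarith

/-- The Chernoff bound for the number of users that store a packet. -/
theorem pulledExpect_card_lt_le (hq : 0 < q) (g : ℕ) (n : Fin N) (f : Fin F' × Fin q) :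
    pulledExpect g (fun T : Config U (Fin F' × Fin q) N => if #(T n f) < g then 1 else 0) ≤
      3 ^ g * Real.exp (-(2 / 3 * (Fintype.card U / q))) := by
  have : NeZero q := ⟨hq.ne'⟩
  have hq' : (0 : ℝ) < q := Nat.cast_pos.2 hq
  -- Exponential tilt with base `1 / 3`: a user stores the packet with probability `1 / q`, giving
  -- the factor `1 - (2 / 3) / q`.
  have hv : Finset.expect (univ : Finset (Fin N → Fin F' → Fin q))
      (fun v => if v n f.1 = f.2 then (1 / 3 : ℝ) else 1) = 1 - 2 / (3 * q) := by
    have h1 := expect_piFinset_apply (fun _ : Fin N => (univ : Finset (Fin F' → Fin q)))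
      (fun _ => univ_nonempty) n (fun v => if v f.1 = f.2 then (1 / 3 : ℝ) else 1)
    have h2 := expect_piFinset_apply (fun _ : Fin F' => (univ : Finset (Fin q)))
      (fun _ => univ_nonempty) f.1 (fun i => if i = f.2 then (1 / 3 : ℝ) else 1)
    rw [Fintype.piFinset_univ] at h1 h2
    rw [h1, h2, Fintype.expect_eq_sum_div_card]
    have h3 : ∀ i : Fin q, (if i = f.2 then (1 / 3 : ℝ) else 1) =
        1 - if i = f.2 then 2 / 3 else 0 := by
      intro i
      split_ifs <;> norm_num
    simp only [h3, sum_sub_distrib, sum_ite_eq']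
    simp
    field_simp
  have hp := prod_expect_piFinset (fun _ : U => (univ : Finset (Fin N → Fin F' → Fin q)))
    (fun _ v => if v n f.1 = f.2 then (1 / 3 : ℝ) else 1)
  simp only [hv, Fintype.piFinset_univ, prod_const, card_univ] at hp
  calc pulledExpect g (fun T : Config U (Fin F' × Fin q) N => if #(T n f) < g then 1 else 0)
      = Finset.expect (univ : Finset (Placement U N F' q)) fun ω =>
          if #(ω.config n f) < g then 1 else 0 := by
        refine expect_congr rfl fun ω _ => ?_
        rw [expect_congr rfl fun T hT => if_congr (card_lt_iff_of_mem_pullDown hT n f) rfl rfl,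
          expect_const (pullDown_nonempty g _)]
    _ ≤ Finset.expect (univ : Finset (Placement U N F' q)) fun ω =>
          3 ^ g * ∏ k, if ω k n f.1 = f.2 then (1 / 3 : ℝ) else 1 := by
        refine expect_le_expect fun ω _ => ?_
        have h1 : ∏ k, (if ω k n f.1 = f.2 then (1 / 3 : ℝ) else 1) =
            (1 / 3) ^ #(ω.config n f) := by
          rw [prod_ite]
          simp [Placement.config]
        rw [h1]
        split_ifs with h
        · calc (1 : ℝ) = 3 ^ g * (1 / 3) ^ g := by rw [← mul_pow]; norm_num
            _ ≤ 3 ^ g * (1 / 3) ^ #(ω.config n f) := by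
              gcongr 3 ^ g * ?_
              exact pow_le_pow_of_le_one (by norm_num) (by norm_num) h.le
        · positivity
    _ = 3 ^ g * (1 - 2 / (3 * q)) ^ Fintype.card U := by rw [← mul_expect, hp]
    _ ≤ 3 ^ g * Real.exp (-(2 / (3 * q))) ^ Fintype.card U := by
        gcongr
        · rw [sub_nonneg, div_le_one (by positivity)]
          have : (1 : ℝ) ≤ q := by exact_mod_cast hq
          linarith
        · exact Real.one_sub_le_exp_neg _
    _ = 3 ^ g * Real.exp (-(2 / 3 * (Fintype.card U / q))) := by
        rw [← Real.exp_nat_mul]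
        congr 2
        field_simp

end Mean

-- Expected rate in one group and in total

section Rate

variable {U : Type} [Fintype U] [DecidableEq U] {N F' q : ℕ}

/-- The expected rate of `ModifiedDelivery` in one group: the two terms come from the packets
with exactly `g` and with fewer than `g` users in their pulled-down sets. -/
theorem pulledExpect_deliveryRate_le (hq : 0 < q) (hF : 0 < F') {g : ℕ} (hg : 0 < g)
    (hgU : g ≤ Fintype.card U) (σ : Schedule U (Fin F' × Fin q)) (d : U → Fin N) {Λ : ℝ}
    (hΛ : Λ = F' * q / ((Fintype.card U).choose g : ℝ)) :
    pulledExpect g (fun T => deliveryRate σ T d) ≤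
      Fintype.card U / ((g : ℝ) + 1) * (1 + Real.sqrt (((g : ℝ) + 1) / Λ)) +
        Fintype.card U * (3 ^ g * Real.exp (-(2 / 3 * (Fintype.card U / q)))) := by
  set K := Fintype.card U
  have hC : (0 : ℝ) < (K.choose g : ℝ) := Nat.cast_pos.2 (Nat.choose_pos hgU)
  have hFq : (0 : ℝ) < F' * q := by positivity
  have hΛ0 : 0 < Λ := by rw [hΛ]; positivity
  set s := Real.sqrt (((g : ℝ) + 1) / Λ) with hs
  have hs0 : 0 < s := Real.sqrt_pos.2 (by positivity)
  have hs2 : s ^ 2 = ((g : ℝ) + 1) / Λ := Real.sq_sqrt (by positivity)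
  -- This choice minimises `a + (g + 1) Λ / (4 a)`: both summands are equal, with sum `Λ s`.
  set a := Λ * s / 2 with ha
  have ha0 : 0 < a := by positivity
  have hpt : ∀ T : Config U (Fin F' × Fin q) N, (∀ n f, #(T n f) ≤ g) →
      deliveryRate σ T d ≤ 1 / (F' * q) *
        (∑ B ∈ powersetCard (g + 1) (univ : Finset U), ((Λ + a) + ∑ k ∈ B, 1 / (4 * a) *
          ((#{f | T (d k) f = B.erase k} : ℝ) - storedMean F' q g (d k) (B.erase k)) ^ 2) +
          ∑ k, ∑ f, if #(T (d k) f) < g then 1 else 0) := by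
    intro T hT
    have h1 := (length_newDelivery_le σ T d).trans (remaining_empty_le T d hT)
    have h2 : ((newDelivery σ T d).length : ℝ) ≤
        ∑ B ∈ powersetCard (g + 1) (univ : Finset U),
          ((B.sup fun k => #{f | T (d k) f = B.erase k} : ℕ) : ℝ) +
          ∑ k, ∑ f, if #(T (d k) f) < g then 1 else 0 := by
      refine (Nat.cast_le.2 h1).trans (le_of_eq ?_)
      simp only [card_filter]
      push_cast
      rfl
    rw [deliveryRate, Fintype.card_prod, Fintype.card_fin, Fintype.card_fin, Nat.cast_mul,
      div_eq_mul_one_div, mul_comm]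
    gcongr
    refine h2.trans ?_
    gcongr with B hB
    have hB' := (mem_powersetCard.1 hB).2
    obtain ⟨k, hk, hsup⟩ := exists_mem_eq_sup B (card_pos.1 (by omega))
      fun k => #{f | T (d k) f = B.erase k}
    rw [hsup]
    set y : ℝ := (#{f | T (d k) f = B.erase k} : ℝ) - storedMean F' q g (d k) (B.erase k)
      with hy
    have h3 : 1 / (4 * a) * y ^ 2 ≤ ∑ k ∈ B, 1 / (4 * a) *
        ((#{f | T (d k) f = B.erase k} : ℝ) - storedMean F' q g (d k) (B.erase k)) ^ 2 :=
      single_le_sum (f := fun k => 1 / (4 * a) *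
        ((#{f | T (d k) f = B.erase k} : ℝ) - storedMean F' q g (d k) (B.erase k)) ^ 2)
        (fun _ _ => by positivity) hk
    have h4 : storedMean F' q g (d k) (B.erase k) ≤ Λ := by
      rw [hΛ]
      exact storedMean_le hq g (d k) (by rw [card_erase_of_mem hk, hB']; rfl)
    -- AM-GM replaces the deviation by its square; the maximum over `B` is then bounded by a sum of
    -- variances, with no independence between users' counts.
    have h5 : y ≤ a + 1 / (4 * a) * y ^ 2 := by
      rw [← sub_nonneg]
      have : a + 1 / (4 * a) * y ^ 2 - y = (2 * a - y) ^ 2 / (4 * a) := by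
        field_simp
        ring
      rw [this]
      positivity
    linarith
  refine (pulledExpect_mono g hpt).trans ?_
  rw [pulledExpect_const_mul, pulledExpect_add, pulledExpect_sum, pulledExpect_sum]
  have hbig : ∀ B ∈ powersetCard (g + 1) (univ : Finset U),
      pulledExpect g (fun T : Config U (Fin F' × Fin q) N => (Λ + a) + ∑ k ∈ B, 1 / (4 * a) *
        ((#{f | T (d k) f = B.erase k} : ℝ) - storedMean F' q g (d k) (B.erase k)) ^ 2) ≤
        Λ * (1 + s) := by
    intro B hB
    have hB' := (mem_powersetCard.1 hB).2
    rw [pulledExpect_add, pulledExpect_const hq, pulledExpect_sum]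
    have h1 : ∀ k ∈ B, pulledExpect g (fun T : Config U (Fin F' × Fin q) N => 1 / (4 * a) *
        ((#{f | T (d k) f = B.erase k} : ℝ) - storedMean F' q g (d k) (B.erase k)) ^ 2) ≤
        1 / (4 * a) * Λ := by
      intro k hk
      have hc : #(B.erase k) = g := by rw [card_erase_of_mem hk, hB']; rfl
      rw [pulledExpect_const_mul]
      gcongr
      refine (pulledExpect_variance_le hq g (d k) (card_pos.1 (by omega))).trans ?_
      rw [hΛ]
      exact storedMean_le hq g (d k) hc
    have h2 := sum_le_card_nsmul B _ _ h1
    rw [hB', nsmul_eq_mul, Nat.cast_add, Nat.cast_one] at h2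
    have h3 : ((g : ℝ) + 1) * (1 / (4 * a) * Λ) = a := by
      have : (g : ℝ) + 1 = s ^ 2 * Λ := by rw [hs2]; field_simp
      rw [this, ha]
      field_simp
      norm_num
    calc _ ≤ Λ + a + a := by linarith
      _ = Λ * (1 + s) := by rw [ha]; ring
  have hsmall : ∀ k ∈ (univ : Finset U),
      pulledExpect g (fun T : Config U (Fin F' × Fin q) N =>
        ∑ f, if #(T (d k) f) < g then (1 : ℝ) else 0) ≤
        F' * q * (3 ^ g * Real.exp (-(2 / 3 * (K / q)))) := by
    intro k _
    rw [pulledExpect_sum]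
    refine (sum_le_card_nsmul _ _ _ fun f _ =>
      pulledExpect_card_lt_le hq g (d k) f).trans (le_of_eq ?_)
    simp [K]
  have h1 := sum_le_card_nsmul _ _ _ hbig
  have h2 := sum_le_card_nsmul _ _ _ hsmall
  rw [card_powersetCard, card_univ, nsmul_eq_mul] at h1
  rw [card_univ, nsmul_eq_mul] at h2
  -- The main term: `binom(K, g + 1) / binom(K, g) = (K - g) / (g + 1)`.
  have h3 : (K.choose (g + 1) : ℝ) * Λ ≤ F' * q * (K / ((g : ℝ) + 1)) := by
    have h4 : (K.choose (g + 1) : ℝ) * ((g : ℝ) + 1) ≤ K.choose g * K := by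
      have := Nat.choose_succ_right_eq K g
      have h5 : K.choose (g + 1) * (g + 1) ≤ K.choose g * K := by
        rw [this]
        exact Nat.mul_le_mul_left _ (Nat.sub_le _ _)
      exact_mod_cast h5
    rw [hΛ, mul_div_assoc', mul_div_assoc', div_le_div_iff₀ hC (by positivity)]
    nlinarith
  calc _ ≤ 1 / ((F' : ℝ) * q) * (F' * q * (K / ((g : ℝ) + 1)) * (1 + s) +
          K * (F' * q * (3 ^ g * Real.exp (-(2 / 3 * (K / q)))))) := by
        gcongr
        · refine h1.trans ?_
          rw [← mul_assoc]
          gcongr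
    _ = _ := by
        have : (F' : ℝ) ≠ 0 := by positivity
        have : (q : ℝ) ≠ 0 := by positivity
        field_simp

/-- By linearity only the marginal law in each group matters. -/
theorem expectedTotalRate_eq (hq : 0 < q) {K m : ℕ} (g : ℕ) (grp : Fin K → Fin m)
    (σ : ∀ j, Schedule (Group grp j) (Fin F' × Fin q)) (d : Fin K → Fin N) :
    expectedTotalRate g grp σ d =
      ∑ j, pulledExpect g (fun T => deliveryRate (σ j) T fun k => d k.1) := by
  have : NeZero q := ⟨hq.ne'⟩
  unfold expectedTotalRate
  simp only [expect_sum_comm]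
  refine sum_congr rfl fun j _ => ?_
  calc _ = Finset.expect (univ : Finset (Placement (Fin K) N F' q)) fun ω =>
        Finset.expect (pullDown g (groupConfig grp ω j)) fun T =>
          deliveryRate (σ j) T fun k => d k.1 := by
        refine expect_congr rfl fun ω _ => ?_
        exact expect_piFinset_apply (fun j => pullDown g (groupConfig grp ω j))
          (fun j => pullDown_nonempty g _) j fun T => deliveryRate (σ j) T fun k => d k.1
    _ = _ := expect_restrict (fun k => grp k = j) fun ω : Placement (Group grp j) N F' q =>
        Finset.expect (pullDown g ω.config) fun T => deliveryRate (σ j) T fun k => d k.1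

end Rate

-- Estimates for the group size and the file size

section Parameters

variable {N : ℕ} {M : ℝ} {g : ℕ}

/-- A bootstrap: an integer `q` at least `e` is at least `3`, so `N / M > 2` and its logarithm is at
least `1 / 2`; a nonempty range with `g ≥ 7` then forces `(N / M) ^ 2 ≥ 21 / 2`.
`Admissible.four_lt` repeats this with logarithm at least `1`. -/
theorem Admissible.three_lt (h : Admissible N M g) : 3 < (N : ℝ) / M := by
  obtain ⟨-, hr, hg, hb⟩ := h
  set x := (N : ℝ) / M with hx
  have h3 : 3 ≤ ratio N M := by
    have : (2 : ℝ) < ratio N M := by linarith [Real.exp_one_gt_d9]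
    exact_mod_cast this
  have hx2 : 2 < x := by
    have : 2 < ⌈x⌉₊ := h3
    simpa using Nat.lt_ceil.1 this
  have hlog : 1 / 2 ≤ Real.log x := by
    have h1 := Real.one_sub_inv_le_log_of_pos (show 0 < x by linarith)
    have h2 : x⁻¹ ≤ 2⁻¹ := inv_anti₀ (by norm_num) hx2.le
    linarith
  have hg' : (7 : ℝ) ≤ g := by exact_mod_cast hg
  have h4 := hg'.trans hb
  rw [le_div_iff₀ (by linarith)] at h4
  nlinarith

theorem Admissible.one_le_log (h : Admissible N M g) : 1 ≤ Real.log ((N : ℝ) / M) := by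
  rw [Real.le_log_iff_exp_le (by linarith [h.three_lt])]
  linarith [h.three_lt, Real.exp_one_lt_d9]

theorem Admissible.mul_log_le (h : Admissible N M g) :
    3 * g * Real.log ((N : ℝ) / M) ≤ ((N : ℝ) / M) ^ 2 := by
  have h1 := h.2.2.2
  rw [le_div_iff₀ (by linarith [h.one_le_log])] at h1
  linarith

theorem Admissible.seven_le (h : Admissible N M g) : (7 : ℝ) ≤ g := by
  exact_mod_cast h.2.2.1

theorem Admissible.four_lt (h : Admissible N M g) : 4 < (N : ℝ) / M := by
  have := h.mul_log_le
  have := h.seven_le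
  have := h.one_le_log
  have := h.three_lt
  nlinarith [mul_le_mul h.seven_le h.one_le_log zero_le_one (by linarith : (0 : ℝ) ≤ g)]

theorem le_ratio (N : ℕ) (M : ℝ) : (N : ℝ) / M ≤ ratio N M := Nat.le_ceil _

theorem Admissible.ratio_lt (h : Admissible N M g) : (ratio N M : ℝ) < (N : ℝ) / M + 1 :=
  Nat.ceil_lt_add_one (by linarith [h.four_lt])

theorem le_groupSize (N : ℕ) (M : ℝ) (g : ℕ) :
    (ratio N M : ℝ) * (3 * g * Real.log ((N : ℝ) / M)) ≤ groupSize N M g := Nat.le_ceil _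

theorem Admissible.groupSize_lt (h : Admissible N M g) :
    (groupSize N M g : ℝ) < (ratio N M : ℝ) * (3 * g * Real.log ((N : ℝ) / M)) + 1 := by
  have := h.one_le_log
  exact Nat.ceil_lt_add_one (by positivity)

theorem Admissible.mul_le_groupSize (h : Admissible N M g) : 12 * g ≤ groupSize N M g := by
  have h1 := le_groupSize N M g
  have h2 := h.one_le_log
  have h3 : (4 : ℝ) ≤ ratio N M := h.four_lt.le.trans (le_ratio N M)
  have h4 : (4 : ℝ) * (3 * g * 1) ≤ (ratio N M : ℝ) * (3 * g * Real.log ((N : ℝ) / M)) := by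
    gcongr
  have h5 : (12 : ℝ) * g ≤ groupSize N M g := by linarith
  exact_mod_cast h5

theorem Admissible.groupSize_le_cube (h : Admissible N M g) :
    (groupSize N M g : ℝ) ≤ 2 * (ratio N M : ℝ) ^ 3 := by
  have h1 := h.groupSize_lt
  have hxq := le_ratio N M
  have hx := h.four_lt
  have h2 : (ratio N M : ℝ) * (3 * g * Real.log ((N : ℝ) / M)) ≤
      ratio N M * (ratio N M : ℝ) ^ 2 := by
    gcongr
    exact h.mul_log_le.trans (by gcongr)
  have h3 : (1 : ℝ) ≤ (ratio N M : ℝ) ^ 3 := one_le_pow₀ (by linarith)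
  nlinarith

/-- `binom(K', g) ≥ 3 ^ g`. -/
theorem Admissible.three_pow_le_choose (h : Admissible N M g) :
    (3 : ℝ) ^ g ≤ (groupSize N M g).choose g := by
  have h1 := Nat.pow_le_choose (α := ℝ) g (groupSize N M g)
  have h2 : 3 * g ≤ groupSize N M g + 1 - g := by have := h.mul_le_groupSize; omega
  have hg : (0 : ℝ) < g := by linarith [h.seven_le]
  refine le_trans ?_ h1
  rw [le_div_iff₀ (by positivity)]
  calc (3 : ℝ) ^ g * (g.factorial : ℝ) ≤ 3 ^ g * (g : ℝ) ^ g := by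
        gcongr
        exact_mod_cast Nat.factorial_le_pow g
    _ = ((3 * g : ℕ) : ℝ) ^ g := by push_cast; rw [mul_pow]
    _ ≤ _ := by gcongr

theorem Admissible.le_log_choose (h : Admissible N M g) :
    (g : ℝ) ≤ Real.log ((groupSize N M g).choose g : ℝ) := by
  have h1 : (0 : ℝ) < (groupSize N M g).choose g := lt_of_lt_of_le (by positivity)
    h.three_pow_le_choose
  rw [Real.le_log_iff_exp_le h1]
  refine le_trans ?_ h.three_pow_le_choose
  rw [← Real.exp_one_pow]
  gcongr
  linarith [Real.exp_one_lt_d9]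

/-- The squared logarithm in the file size supplies the factor `g ^ 2`, which makes `Λ` dominate `g
+ 1`. -/
theorem Admissible.sq_le_groupOrder (h : Admissible N M g) :
    ((groupSize N M g).choose g : ℝ) * (g : ℝ) ^ 2 ≤ groupOrder N M g := by
  unfold groupOrder
  gcongr
  exact h.le_log_choose

theorem Admissible.one_le_groupOrder (h : Admissible N M g) : 1 ≤ groupOrder N M g := by
  refine le_trans ?_ h.sq_le_groupOrder
  have h1 : (1 : ℝ) ≤ (groupSize N M g).choose g :=
    (one_le_pow₀ (by norm_num)).trans h.three_pow_le_choose
  have h2 : (1 : ℝ) ≤ (g : ℝ) ^ 2 := one_le_pow₀ (by linarith [h.seven_le])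
  nlinarith

theorem Admissible.fileSize_le (h : Admissible N M g) :
    (fileSize 1 N M g : ℝ) ≤ 2 * (groupOrder N M g * ratio N M) := by
  have h1 := h.one_le_groupOrder
  have h2 := (Nat.ceil_lt_add_one (zero_le_one.trans h1)).le
  rw [fileSize, one_mul, Nat.cast_mul]
  calc (ratio N M : ℝ) * (⌈groupOrder N M g⌉₊ : ℝ) ≤ ratio N M * (2 * groupOrder N M g) := by
        gcongr
        linarith
    _ = _ := by ring

/-- `binom(K', g) ≤ (e K' / g) ^ g`, with the rounding of `K'` absorbed in a constant. -/
theorem Admissible.choose_le (h : Admissible N M g) :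
    ((groupSize N M g).choose g : ℝ) ≤
      Real.exp 1 * (3 * Real.exp 1 * ratio N M * Real.log ((N : ℝ) / M)) ^ g := by
  have hL := h.one_le_log
  have hg := h.seven_le
  have hq : (4 : ℝ) ≤ ratio N M := h.four_lt.le.trans (le_ratio N M)
  set L := Real.log ((N : ℝ) / M)
  set q : ℝ := (ratio N M : ℝ)
  have hg0 : (0 : ℝ) < g := by linarith
  -- Rounding up adds at most `1 ≤ 3 q L`, a relative error of at most `1 / g`; its `g`-th power
  -- costs only the factor `e`.
  have h1 : (groupSize N M g : ℝ) ≤ g * (3 * q * L) * Real.exp (1 / g) := by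
    have h2 := h.groupSize_lt
    have h3 : 1 / (g : ℝ) + 1 ≤ Real.exp (1 / g) := Real.add_one_le_exp _
    have h4 : 1 ≤ 3 * q * L := by nlinarith
    calc (groupSize N M g : ℝ) ≤ g * (3 * q * L) + 1 := by linarith
      _ ≤ g * (3 * q * L) * (1 / g + 1) := by
          have : g * (3 * q * L) * (1 / g + 1) = g * (3 * q * L) + 3 * q * L := by
            field_simp
            ring
          linarith
      _ ≤ _ := by gcongr
  have h5 : (g : ℝ) ^ g ≤ Real.exp 1 ^ g * g.factorial := by
    have := Real.pow_div_factorial_le_exp (x := g) hg0.le g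
    rwa [div_le_iff₀ (by positivity), ← Real.exp_one_pow] at this
  have h6 : Real.exp (1 / g) ^ g = Real.exp 1 := by
    rw [← Real.exp_nat_mul]
    congr 1
    field_simp
  refine (Nat.choose_le_pow_div (α := ℝ) g (groupSize N M g)).trans ?_
  rw [div_le_iff₀ (by positivity)]
  calc (groupSize N M g : ℝ) ^ g ≤ (g * (3 * q * L) * Real.exp (1 / g)) ^ g := by gcongr
    _ = (g : ℝ) ^ g * (3 * q * L) ^ g * Real.exp 1 := by rw [mul_pow, mul_pow, h6]
    _ ≤ (Real.exp 1 ^ g * g.factorial) * (3 * q * L) ^ g * Real.exp 1 := by gcongr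
    _ = _ := by
        rw [show 3 * Real.exp 1 * q * L = Real.exp 1 * (3 * q * L) by ring, mul_pow _ _ g]
        ring

theorem Admissible.log_choose_le (h : Admissible N M g) :
    Real.log ((groupSize N M g).choose g : ℝ) ≤ 7 * (g * Real.log ((N : ℝ) / M)) := by
  have hL := h.one_le_log
  have hg := h.seven_le
  have hx := h.four_lt
  have hq : (4 : ℝ) ≤ ratio N M := h.four_lt.le.trans (le_ratio N M)
  have hqx := h.ratio_lt
  have h1 : (0 : ℝ) < (groupSize N M g).choose g := lt_of_lt_of_le (by positivity)
    h.three_pow_le_choose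
  have h2 := Real.log_le_log h1 h.choose_le
  set x := (N : ℝ) / M
  set L := Real.log x with hLdef
  set q : ℝ := (ratio N M : ℝ)
  rw [Real.log_mul (by positivity) (by positivity), Real.log_exp, Real.log_pow,
    Real.log_mul (by positivity) (by positivity), Real.log_mul (by positivity) (by positivity),
    Real.log_mul (by positivity) (by positivity), Real.log_exp] at h2
  have h3 : Real.log 3 ≤ 2 := by
    have := Real.log_le_sub_one_of_pos (show (0 : ℝ) < 3 by norm_num)
    linarith
  have h4 : Real.log q ≤ 2 * L := by
    have : Real.log q ≤ Real.log (x ^ 2) := Real.log_le_log (by linarith) (by nlinarith)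
    rwa [Real.log_pow, Nat.cast_ofNat] at this
  have h5 : Real.log L ≤ L := by
    have := Real.log_le_sub_one_of_pos (show (0 : ℝ) < L by linarith)
    linarith
  have h6 : 1 ≤ g * L := by nlinarith
  -- The four terms are at most `2`, `1`, `2 L` and `L`, and `3 ≤ 3 L`. The prefactor `e` of
  -- `choose_le` raises `6` to `7`.
  have h7 : (g : ℝ) * (Real.log 3 + 1 + Real.log q + Real.log L) ≤ g * (6 * L) := by
    gcongr
    linarith
  linarith

theorem Admissible.groupOrder_le (h : Admissible N M g) :
    groupOrder N M g ≤ 49 * Real.exp 1 * ((ratio N M : ℝ) ^ g * (3 * Real.exp 1) ^ g *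
      Real.log ((N : ℝ) / M) ^ (g + 2) * (g : ℝ) ^ 2) := by
  have h0 : 0 ≤ Real.log ((groupSize N M g).choose g : ℝ) :=
    (Nat.cast_nonneg g).trans h.le_log_choose
  have hL := h.one_le_log
  unfold groupOrder
  calc _ ≤ (Real.exp 1 * (3 * Real.exp 1 * ratio N M * Real.log ((N : ℝ) / M)) ^ g) *
        (7 * (g * Real.log ((N : ℝ) / M))) ^ 2 := by
        gcongr
        · exact h.choose_le
        · exact h.log_choose_le
    _ = _ := by
        simp only [mul_pow, pow_add]
        ring

theorem Admissible.fileSize_le_pow (h : Admissible N M g) :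
    (fileSize 1 N M g : ℝ) ≤ 98 * Real.exp 1 * ((ratio N M : ℝ) ^ (g + 1) *
      (3 * Real.exp 1) ^ g * Real.log ((N : ℝ) / M) ^ (g + 2) * (g : ℝ) ^ 2) := by
  refine h.fileSize_le.trans ?_
  calc _ ≤ 2 * (49 * Real.exp 1 * ((ratio N M : ℝ) ^ g * (3 * Real.exp 1) ^ g *
        Real.log ((N : ℝ) / M) ^ (g + 2) * (g : ℝ) ^ 2) * ratio N M) := by
        gcongr
        exact h.groupOrder_le
    _ = _ := by
        rw [pow_succ (ratio N M : ℝ) g]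
        ring

/-- With `x = N / M`, the rounding factor is at most `(1 + 1 / x) ^ (g + 1) ≤ exp ((g + 1) / x)`,
which stays bounded because `g ≤ A x`. -/
theorem Admissible.ratio_pow_le (h : Admissible N M g) {A : ℝ}
    (hA : (g : ℝ) ≤ A * ((N : ℝ) / M)) :
    (ratio N M : ℝ) ^ (g + 1) ≤ Real.exp (A + 1) * ((N : ℝ) / M) ^ (g + 1) := by
  have hx := h.four_lt
  have hqx := h.ratio_lt
  set x := (N : ℝ) / M
  have hx0 : 0 < x := by linarith
  have h1 : (ratio N M : ℝ) ≤ Real.exp (1 / x) * x := by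
    have h2 : 1 / x + 1 ≤ Real.exp (1 / x) := Real.add_one_le_exp _
    have h3 : (1 / x + 1) * x = x + 1 := by field_simp; ring
    nlinarith
  calc (ratio N M : ℝ) ^ (g + 1) ≤ (Real.exp (1 / x) * x) ^ (g + 1) := by gcongr
    _ = Real.exp ((g + 1) / x) * x ^ (g + 1) := by
        rw [mul_pow, ← Real.exp_nat_mul]
        congr 2
        push_cast
        ring
    _ ≤ _ := by
        gcongr
        rw [div_le_iff₀ hx0]
        nlinarith

/-- The probability that a packet is stored by fewer than `g` users of a group is negligible. -/
theorem Admissible.chernoff_le (h : Admissible N M g) :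
    ((g : ℝ) + 1) * (3 ^ g * Real.exp (-(2 / 3 * (groupSize N M g / ratio N M)))) ≤
      9 / ratio N M := by
  have hL := h.one_le_log
  have hg := h.seven_le
  have hx := h.four_lt
  have hK := le_groupSize N M g
  have hm := h.mul_log_le
  have hqx := h.ratio_lt
  have hq : (4 : ℝ) ≤ ratio N M := h.four_lt.le.trans (le_ratio N M)
  set x := (N : ℝ) / M
  set L := Real.log x with hLdef
  set q : ℝ := (ratio N M : ℝ)
  have hx0 : 0 < x := by linarith
  -- The factor `3 g log x` in the group size turns the Chernoff exponent `2 / 3` into `x ^ (-2 g)`.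
  have h1 : Real.exp (-(2 / 3 * (groupSize N M g / q))) ≤ (1 / x ^ 2) ^ g := by
    have h2 : 3 * g * L ≤ groupSize N M g / q := by
      rw [le_div_iff₀ (by linarith)]
      linarith
    have h3 : (1 / x ^ 2) ^ g = Real.exp (-(2 / 3 * (3 * g * L))) := by
      have h4 : 1 / x ^ 2 = Real.exp (-(2 * L)) := by
        rw [Real.exp_neg, one_div, two_mul, Real.exp_add, hLdef, Real.exp_log hx0, sq]
      rw [h4, ← Real.exp_nat_mul]
      congr 1
      ring
    rw [h3]
    gcongr
  have h5 : (g : ℝ) + 1 ≤ x ^ 2 := by nlinarith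
  calc ((g : ℝ) + 1) * (3 ^ g * Real.exp (-(2 / 3 * (groupSize N M g / q))))
      ≤ x ^ 2 * (3 ^ g * (1 / x ^ 2) ^ g) := by gcongr
    _ = x ^ 2 * (3 / x ^ 2) ^ g := by rw [← mul_pow, mul_one_div]
    _ ≤ x ^ 2 * (3 / x ^ 2) ^ 2 := by
        gcongr x ^ 2 * ?_
        refine pow_le_pow_of_le_one (by positivity) ?_ (by have := h.2.2.1; omega)
        rw [div_le_one (by positivity)]
        nlinarith
    _ = 9 / x ^ 2 := by
        field_simp
        norm_num
    _ ≤ 9 / q := by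
        gcongr
        nlinarith

/-- The relative deviation of the expected rate from `K / (g + 1)` in terms of the group size. -/
noncomputable def rateError (n : ℕ) : ℝ :=
  Real.sqrt (2 / ((n : ℝ) / 2) ^ (1 / 3 : ℝ)) + 9 / ((n : ℝ) / 2) ^ (1 / 3 : ℝ)

theorem tendsto_rateError : Filter.Tendsto rateError Filter.atTop (nhds 0) := by
  have h : Filter.Tendsto (fun n : ℕ => ((n : ℝ) / 2) ^ (1 / 3 : ℝ)) Filter.atTop Filter.atTop :=
    (tendsto_rpow_atTop (by norm_num)).comp
      (tendsto_natCast_atTop_atTop.atTop_div_const (by norm_num))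
  have h1 := (Real.continuous_sqrt.tendsto 0).comp (h.const_div_atTop 2)
  rw [Real.sqrt_zero] at h1
  have h2 := h1.add (h.const_div_atTop 9)
  rw [add_zero] at h2
  exact h2

theorem rateError_nonneg (n : ℕ) : 0 ≤ rateError n := by
  unfold rateError
  positivity

/-- The cubic bound on `K'` gives `q ≥ (K' / 2) ^ (1 / 3)`, so errors in `q` become a function of
`K'` alone. -/
theorem Admissible.le_rateError (h : Admissible N M g) :
    Real.sqrt (2 / ratio N M) + 9 / ratio N M ≤ rateError (groupSize N M g) := by
  have hK : (0 : ℝ) < groupSize N M g := by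
    have h1 := h.mul_le_groupSize
    have h2 := h.2.2.1
    have : 0 < groupSize N M g := by omega
    exact_mod_cast this
  have hy : (0 : ℝ) < ((groupSize N M g : ℝ) / 2) ^ (1 / 3 : ℝ) := by positivity
  have hle : ((groupSize N M g : ℝ) / 2) ^ (1 / 3 : ℝ) ≤ ratio N M := by
    calc ((groupSize N M g : ℝ) / 2) ^ (1 / 3 : ℝ) ≤ ((ratio N M : ℝ) ^ 3) ^ (1 / 3 : ℝ) := by
          gcongr
          linarith [h.groupSize_le_cube]
      _ = ratio N M := by
          rw [← Real.rpow_natCast, ← Real.rpow_mul (by positivity)]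
          norm_num
  unfold rateError
  gcongr

theorem Admissible.le_of_fileSize_le (h : Admissible N M g) {F' : ℕ}
    (hF : fileSize 1 N M g ≤ ratio N M * F') : groupOrder N M g ≤ F' := by
  have hq : 0 < ratio N M := by
    have : (0 : ℝ) < ratio N M := by linarith [h.four_lt, le_ratio N M]
    exact_mod_cast this
  have h1 := Nat.le_of_mul_le_mul_left hF hq
  rw [one_mul] at h1
  exact (Nat.le_ceil _).trans (by exact_mod_cast h1)

/-- The expected total rate is `K / (g + 1)` up to a factor that tends to one. -/
theorem Admissible.expectedTotalRate_le (h : Admissible N M g) {F' : ℕ}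
    (hF : fileSize 1 N M g ≤ ratio N M * F') {K m : ℕ} (grp : Fin K → Fin m)
    (hgrp : ∀ j, Fintype.card (Group grp j) = groupSize N M g)
    (σ : ∀ j, Schedule (Group grp j) (Fin F' × Fin (ratio N M))) (d : Fin K → Fin N) :
    expectedTotalRate g grp σ d ≤
      (K : ℝ) / ((g : ℝ) + 1) * (1 + rateError (groupSize N M g)) := by
  have hg := h.seven_le
  have hq0 : (0 : ℝ) < ratio N M := by linarith [h.four_lt, le_ratio N M]
  have hq : 0 < ratio N M := by exact_mod_cast hq0
  have hF1 := h.le_of_fileSize_le hF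
  have hF0 : 0 < F' := by
    have : (0 : ℝ) < F' := by linarith [h.one_le_groupOrder]
    exact_mod_cast this
  have hK : (K : ℝ) = m * groupSize N M g := by
    have h1 := Finset.card_eq_sum_card_fiberwise (f := grp) (s := univ) (t := univ)
      (fun _ _ => by simp)
    have h2 : ∀ j, #(univ.filter fun k => grp k = j) = groupSize N M g := by
      intro j
      rw [← hgrp j, Fintype.card_subtype]
    simp only [h2, sum_const, card_univ, Fintype.card_fin, smul_eq_mul] at h1
    exact_mod_cast h1
  have hC : (0 : ℝ) < (groupSize N M g).choose g := lt_of_lt_of_le (by positivity)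
    h.three_pow_le_choose
  set Λ : ℝ := F' * ratio N M / ((groupSize N M g).choose g : ℝ) with hΛ
  -- Here `Λ ≥ q g ^ 2` and `g + 1 ≤ 2 g ^ 2`.
  have hs : Real.sqrt (((g : ℝ) + 1) / Λ) ≤ Real.sqrt (2 / ratio N M) := by
    refine Real.sqrt_le_sqrt ?_
    have h1 : (ratio N M : ℝ) * g ^ 2 ≤ Λ := by
      rw [hΛ, le_div_iff₀ hC]
      nlinarith [h.sq_le_groupOrder]
    calc ((g : ℝ) + 1) / Λ ≤ (2 * g ^ 2) / (ratio N M * g ^ 2) := by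
          gcongr
          nlinarith
      _ = 2 / ratio N M := by field_simp
  have hj : ∀ j ∈ (univ : Finset (Fin m)),
      pulledExpect g (fun T => deliveryRate (σ j) T fun k => d k.1) ≤
      (groupSize N M g : ℝ) / ((g : ℝ) + 1) * (1 + rateError (groupSize N M g)) := by
    intro j _
    have hgK : g ≤ Fintype.card (Group grp j) := by
      rw [hgrp j]
      have := h.mul_le_groupSize
      omega
    refine (pulledExpect_deliveryRate_le hq hF0 (by have := h.2.2.1; omega) hgK (σ j) _
      (Λ := Λ) (by rw [hgrp j])).trans ?_
    rw [hgrp j]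
    calc _ = (groupSize N M g : ℝ) / ((g : ℝ) + 1) * (1 + (Real.sqrt (((g : ℝ) + 1) / Λ) +
          ((g : ℝ) + 1) * (3 ^ g * Real.exp (-(2 / 3 * (groupSize N M g / ratio N M)))))) := by
          field_simp
          ring
      _ ≤ _ := by
          gcongr
          linarith [h.le_rateError, h.chernoff_le]
  rw [expectedTotalRate_eq hq]
  refine (sum_le_card_nsmul _ _ _ hj).trans (le_of_eq ?_)
  rw [card_univ, Fintype.card_fin, nsmul_eq_mul, hK]
  ring

end Parameters

end CodedCaching

-- Assembly of the theorem

theorem theorem8 :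
    ∃ c : ℝ, 0 < c ∧
      -- expected rate, for every file size `F = ⌈N/M⌉ F'` that is at least `fileSize c N M g`
      (∃ ε : ℕ → ℝ, Filter.Tendsto ε Filter.atTop (nhds 0) ∧
        ∀ (N : ℕ) (M : ℝ) (g : ℕ), CodedCaching.Admissible N M g →
        ∀ F' : ℕ, CodedCaching.fileSize c N M g ≤ CodedCaching.ratio N M * F' →
        ∀ (K m : ℕ) (grp : Fin K → Fin m),
          (∀ j, Fintype.card (CodedCaching.Group grp j) = CodedCaching.groupSize N M g) →
        ∀ (σ : ∀ j, CodedCaching.Schedule (CodedCaching.Group grp j)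
            (Fin F' × Fin (CodedCaching.ratio N M))) (d : Fin K → Fin N),
          CodedCaching.expectedTotalRate g grp σ d ≤
            4 / 3 * ((K : ℝ) / ((g : ℝ) + 1)) * (1 + ε (CodedCaching.groupSize N M g))) ∧
      -- the order of this file size
      (∃ C : ℝ, 0 < C ∧ ∀ (N : ℕ) (M : ℝ) (g : ℕ), CodedCaching.Admissible N M g →
        (CodedCaching.fileSize c N M g : ℝ) ≤
            C * (CodedCaching.groupOrder N M g * (CodedCaching.ratio N M : ℝ)) ∧
        (CodedCaching.fileSize c N M g : ℝ) ≤
            C * ((CodedCaching.ratio N M : ℝ) ^ (g + 1) * (3 * Real.exp 1) ^ g *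
              Real.log ((N : ℝ) / M) ^ (g + 2) * (g : ℝ) ^ 2)) ∧
      (∀ A : ℝ, ∃ C : ℝ, 0 < C ∧ ∀ (N : ℕ) (M : ℝ) (g : ℕ), CodedCaching.Admissible N M g →
        (g : ℝ) ≤ A * ((N : ℝ) / M) →
        (CodedCaching.fileSize c N M g : ℝ) ≤
            C * (((N : ℝ) / M) ^ (g + 1) * (3 * Real.exp 1) ^ g *
              Real.log ((N : ℝ) / M) ^ (g + 2) * (g : ℝ) ^ 2)) := by
  -- Already `c = 1` suffices. In `98 e`, rounding up contributes `2`, the squared logarithm `7 ^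
  -- 2`, and the rounding of `K'` the factor `e`.
  refine ⟨1, one_pos, ⟨CodedCaching.rateError, CodedCaching.tendsto_rateError, ?_⟩,
    ⟨98 * Real.exp 1, by positivity, ?_⟩, fun A => ⟨98 * Real.exp 1 * Real.exp (A + 1),
    by positivity, ?_⟩⟩
  · intro N M g h F' hF K m grp hgrp σ d
    refine (h.expectedTotalRate_le hF grp hgrp σ d).trans ?_
    have := CodedCaching.rateError_nonneg (CodedCaching.groupSize N M g)
    gcongr
    exact le_mul_of_one_le_left (by positivity) (by norm_num)
  · intro N M g h
    refine ⟨h.fileSize_le.trans ?_, h.fileSize_le_pow⟩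
    have := h.one_le_groupOrder
    gcongr
    linarith [Real.exp_one_gt_d9]
  · intro N M g h hA
    refine h.fileSize_le_pow.trans ?_
    have hL := h.one_le_log
    rw [mul_assoc (98 * Real.exp 1) (Real.exp (A + 1)), ← mul_assoc (Real.exp (A + 1)),
      ← mul_assoc (Real.exp (A + 1)), ← mul_assoc (Real.exp (A + 1))]
    gcongr
    exact h.ratio_pow_le hA
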